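/- Let $\mathrm G$ be a simply connected three-dimensional Lie group. For a coframe $\mathfrak e=(e_u,e_l,e_n)$ on $\mathrm G$ put $h_{\mathfrak e}=e_u\otimes e_u+e_l\otimes e_l+e_n\otimes e_n$. A left-invariant parallel spinor flow on $\mathrm G$ is a pair $\{\beta_t,\mathfrak e^t\}_{t\in\mathcal I}$, where $\mathcal I\subseteq\mathbb R$ is an open interval containing $0$, $\beta_t$ is a smooth family of non-zero real constants and $\mathfrak e^t=(e^t_u,e^t_l,e^t_n)$ is a smooth family of left-invariant coframes on $\mathrm G$, such that for all $t\in\mathcal I$ $$\partial_t e^t_a+\beta_t\,\Theta_t(e^t_a)=0,\qquad \mathrm d e^t_a=\Theta_t(e^t_a)\wedge e^t_u\quad(a=u,l,n),\qquad \partial_t\big(\Theta_t(e^t_u)\big)=0,\qquad \mathrm d\big(\Theta_t(e^t_u)\big)=0,$$ where $h_t=h_{\mathfrak e^t}$, $\Theta_t=-\frac1{2\beta_t}\partial_t h_t$ and $\Theta_t(e^t_a)$ is the contraction of $\Theta_t$ with the $h_t$-dual vector field of $e^t_a$. Its Hamiltonian function is $\mathcal H_t=\mathrm R_{h_t}-|\Theta_t|^2_{h_t}+\mathrm{Tr}_{h_t}(\Theta_t)^2$,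 with $\mathrm R_{h_t}$ the scalar curvature. Write $\Theta_0=\sum_{a,b}\Theta_{ab}\,e^0_a\otimes e^0_b$, $\lambda=\sqrt{\Theta_{ul}^2+\Theta_{un}^2}$, $\mathcal B_t=\int_0^t\beta_\tau\,\mathrm d\tau$ and, if $\lambda\neq0$, $y_t=\lambda\mathcal B_t+\arctan(\Theta_{uu}/\lambda)$. Then the components $\Theta_{ab}$ and, for every $t\in\mathcal I$, the function $\mathcal H_t$ are constant on $\mathrm G$, and: 1. If $\lambda=0$, then for every $t\in\mathcal I$ one has $1-\Theta_{uu}\mathcal B_t>0$ and $$\mathcal H_t=\frac{\mathcal H_0}{(1-\Theta_{uu}\mathcal B_t)^2}.$$ 2. If $\lambda\neq0$, then for every $t\in\mathcal I$ one has $|y_t|<\pi/2$ and $$\mathcal H_t=\frac{\lambda^2\,\mathcal H_0}{\lambda^2+\Theta_{uu}^2}\,\sec^2(y_t).$$ 3. For every $t\in\mathcal I$, $\mathcal H_t=0$ if and only if $\mathcal H_0=0$. In particular $\mathcal H_t=0$ for all $t\in\mathcal I$ if and only if $\mathcal H_0=0$. -/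

import Mathlib

open scoped Manifold ContDiff

namespace ParallelSpinor

noncomputable section

variable {M : Type*} [TopologicalSpace M] [ChartedSpace (EuclideanSpace ℝ (Fin 3)) M]

/-- Vector fields on the three-manifold `M` (no regularity imposed). -/
abbrev VField (M : Type*) [TopologicalSpace M] [ChartedSpace (EuclideanSpace ℝ (Fin 3)) M] :
    Type _ :=
  (p : M) → TangentSpace (𝓡 3) p

/-- Fields of real functions on the tangent spaces; one-forms are those that are fibrewise
linear. -/
abbrev Covector (M : Type*) [TopologicalSpace M] [ChartedSpace (EuclideanSpace ℝ (Fin 3)) M] :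
    Type _ :=
  (p : M) → TangentSpace (𝓡 3) p → ℝ

/-- A vector field is smooth if it is a `C^∞` section of the tangent bundle. -/
def IsSmoothField [IsManifold (𝓡 3) ∞ M] (X : VField M) : Prop :=
  ContMDiff (𝓡 3) (𝓡 3).tangent ∞ (fun p => (⟨p, X p⟩ : TangentBundle (𝓡 3) M))

/-- The derivative `X(f)` of a function along a vector field. -/
def dirDeriv (X : VField M) (f : M → ℝ) (p : M) : ℝ :=
  mvfderiv (𝓡 3) f p (X p)

/-- The exterior derivative of a one-form evaluated on two vector fields:
`dη(X, Y) = X(η(Y)) - Y(η(X)) - η([X, Y])`. -/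
def extD (η : Covector M) (X Y : VField M) (p : M) : ℝ :=
  dirDeriv X (fun q => η q (Y q)) p - dirDeriv Y (fun q => η q (X q)) p
    - η p (VectorField.mlieBracket (𝓡 3) X Y p)

/-- The wedge product of two one-forms evaluated on two vector fields:
`(α ∧ η)(X, Y) = α(X) η(Y) - α(Y) η(X)`. -/
def wedge (α η : Covector M) (X Y : VField M) (p : M) : ℝ :=
  α p (X p) * η p (Y p) - α p (Y p) * η p (X p)

/-- A coframe `(e_u, e_l, e_n)` on `M`: at each point a linear isomorphism `T_pM ≃ ℝ³`, whose
components `0, 1, 2` are the one-forms `e_u, e_l, e_n`. -/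
abbrev Coframe (M : Type*) [TopologicalSpace M] [ChartedSpace (EuclideanSpace ℝ (Fin 3)) M] :
    Type _ :=
  (p : M) → (TangentSpace (𝓡 3) p ≃L[ℝ] (Fin 3 → ℝ))

/-- The one-form `e_a` of a coframe. -/
def form (e : Coframe M) (a : Fin 3) : Covector M :=
  fun p v => e p v a

/-- The dual frame `E_a`, determined by `e_b(E_a) = δ_ab`. It is also the metric dual of `e_a` with
respect to the metric `h_e` below. -/
def frame (e : Coframe M) (a : Fin 3) : VField M :=
  fun p => (e p).symm (Pi.single a 1)

/-- The Riemannian metric `h_e = e_u ⊗ e_u + e_l ⊗ e_l + e_n ⊗ e_n`. -/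
def metric (e : Coframe M) (p : M) (v w : TangentSpace (𝓡 3) p) : ℝ :=
  ∑ a, form e a p v * form e a p w

/-- The Koszul expression of `h_e`, which equals `2 h_e(∇_X Y, Z)`. -/
def koszul (e : Coframe M) (X Y Z : VField M) (p : M) : ℝ :=
  dirDeriv X (fun q => metric e q (Y q) (Z q)) p
    + dirDeriv Y (fun q => metric e q (X q) (Z q)) p
    - dirDeriv Z (fun q => metric e q (X q) (Y q)) p
    + metric e p (VectorField.mlieBracket (𝓡 3) X Y p) (Z p)
    - metric e p (VectorField.mlieBracket (𝓡 3) X Z p) (Y p)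
    - metric e p (VectorField.mlieBracket (𝓡 3) Y Z p) (X p)

/-- The Levi-Civita connection `∇_X Y` of `h_e`, expanded in the `h_e`-orthonormal frame `E_a`. -/
def leviCivita (e : Coframe M) (X Y : VField M) : VField M :=
  fun p => ∑ a, ((1 / 2 : ℝ) * koszul e X Y (frame e a) p) • frame e a p

/-- The curvature `R(X, Y)Z = ∇_X ∇_Y Z - ∇_Y ∇_X Z - ∇_[X,Y] Z` of `h_e`. -/
def curvature (e : Coframe M) (X Y Z : VField M) : VField M :=
  fun p => leviCivita e X (leviCivita e Y Z) p - leviCivita e Y (leviCivita e X Z) p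
    - leviCivita e (VectorField.mlieBracket (𝓡 3) X Y) Z p

/-- The scalar curvature of `h_e`, as the trace `∑ h_e(R(E_a, E_b)E_b, E_a)` over the orthonormal
frame. -/
def scalarCurvature (e : Coframe M) (p : M) : ℝ :=
  ∑ a, ∑ b, metric e p (curvature e (frame e a) (frame e b) (frame e b) p) (frame e a p)

/-- The shape operator `Θ_t = -(1 / (2 β_t)) ∂_t h_{e^t}` as a symmetric two-tensor. -/
def shape (β : ℝ → ℝ) (e : ℝ → Coframe M) (t : ℝ) (p : M) (v w : TangentSpace (𝓡 3) p) : ℝ :=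
  -(1 / (2 * β t)) * deriv (fun s => metric (e s) p v w) t

/-- The one-form `Θ_t(e_a^t)`, i.e. `Θ_t` contracted with the metric dual of `e_a^t`. -/
def shapeForm (β : ℝ → ℝ) (e : ℝ → Coframe M) (t : ℝ) (a : Fin 3) : Covector M :=
  fun p v => shape β e t p (frame (e t) a p) v

/-- The components `Θ^t_{ab}`, where `Θ_t = ∑ Θ^t_{ab} e_a^t ⊗ e_b^t`. -/
def shapeComp (β : ℝ → ℝ) (e : ℝ → Coframe M) (t : ℝ) (a b : Fin 3) (p : M) : ℝ :=
  shape β e t p (frame (e t) a p) (frame (e t) b p)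

/-- The Hamiltonian function `𝓗_t = R_{h_t} - |Θ_t|² + Tr(Θ_t)²`. -/
def hamiltonian (β : ℝ → ℝ) (e : ℝ → Coframe M) (t : ℝ) (p : M) : ℝ :=
  scalarCurvature (e t) p - (∑ a, ∑ b, shapeComp β e t a b p ^ 2)
    + (∑ a, shapeComp β e t a a p) ^ 2

/-- `λ = √(Θ_ul² + Θ_un²)`, computed from the initial shape operator `Θ = Θ_0`. -/
def lam (β : ℝ → ℝ) (e : ℝ → Coframe M) (p : M) : ℝ :=
  Real.sqrt (shapeComp β e 0 0 1 p ^ 2 + shapeComp β e 0 0 2 p ^ 2)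

/-- `𝓑_t = ∫_0^t β_τ dτ`. -/
def bint (β : ℝ → ℝ) (t : ℝ) : ℝ :=
  ∫ τ in (0 : ℝ)..t, β τ

/-- `y_t = λ 𝓑_t + arctan(Θ_uu / λ)`. -/
def phase (β : ℝ → ℝ) (e : ℝ → Coframe M) (p : M) (t : ℝ) : ℝ :=
  lam β e p * bint β t + Real.arctan (shapeComp β e 0 0 0 p / lam β e p)

end

/-- A coframe on a Lie group is left-invariant if every left translation pulls each of its
one-forms back to itself. -/
def IsLeftInvariant {G : Type*} [TopologicalSpace G]
    [ChartedSpace (EuclideanSpace ℝ (Fin 3)) G] [Group G] (e : Coframe G) : Prop :=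
  ∀ (g p : G) (v : TangentSpace (𝓡 3) p),
    e (g * p) (mfderiv (𝓡 3) (𝓡 3) (fun x : G => g * x) p v) = e p v

/-- A left-invariant parallel spinor flow `{β_t, e^t}` on a three-dimensional Lie group, for `t` in
an open interval `J` containing `0`: a smooth family of non-zero constants `β_t` and a smooth family
of left-invariant coframes `e^t` that solve
`∂_t e^t + β_t Θ_t(e^t) = 0`, `d e^t = Θ_t(e^t) ∧ e^t_u`, `∂_t (Θ_t(e^t_u)) = 0`,
`d (Θ_t(e^t_u)) = 0`. -/
structure IsLeftInvariantFlow {G : Type*} [TopologicalSpace G]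
    [ChartedSpace (EuclideanSpace ℝ (Fin 3)) G] [Group G] [LieGroup (𝓡 3) ∞ G]
    (J : Set ℝ) (β : ℝ → ℝ) (e : ℝ → Coframe G) : Prop where
  isOpen : IsOpen J
  ordConnected : J.OrdConnected
  zero_mem : (0 : ℝ) ∈ J
  smooth_beta : ContDiffOn ℝ ∞ β J
  beta_ne_zero : ∀ t ∈ J, β t ≠ 0
  smooth_coframe : ∀ (p : G) (v : TangentSpace (𝓡 3) p) (a : Fin 3),
    ContDiffOn ℝ ∞ (fun t => form (e t) a p v) J
  leftInvariant : ∀ t ∈ J, IsLeftInvariant (e t)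
  evolution : ∀ t ∈ J, ∀ (a : Fin 3) (p : G) (v : TangentSpace (𝓡 3) p),
    deriv (fun s => form (e s) a p v) t + β t * shapeForm β e t a p v = 0
  structureEq : ∀ t ∈ J, ∀ (a : Fin 3) (X Y : VField G), IsSmoothField X → IsSmoothField Y →
    ∀ p : G, extD (form (e t) a) X Y p = wedge (shapeForm β e t a) (form (e t) 0) X Y p
  shape_u_const : ∀ t ∈ J, ∀ (p : G) (v : TangentSpace (𝓡 3) p),
    deriv (fun s => shapeForm β e s 0 p v) t = 0
  shape_u_closed : ∀ t ∈ J, ∀ X Y : VField G, IsSmoothField X → IsSmoothField Y →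
    ∀ p : G, extD (shapeForm β e t 0) X Y p = 0

end ParallelSpinor

/-! Left invariance reduces the flow to an ODE for the symmetric matrix `T = shapeMatrix β e t` of
components of `Θ_t` in the moving frame. The structure equation gives `[v, w] = v₀ T w - w₀ T v`
(`form_bracket`), so the scalar curvature, and with it the Hamiltonian, is a quadratic polynomial in
`T` (`hamiltonian_eq`). Write `u, l, n` for the first row of `T`. Closedness of `Θ_t(e_u)` says that
the entries of `T²` in positions `0b`, `b ≠ 0`, vanish; its constancy in time gives `T₀b' = β
(T²)₀b`. Hence `l, n` and `λ² = l² + n²` are conserved and `u' = β (u² + λ²)`. Differentiating the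
structure equation on vectors fixed in time (`deriv_structure`) gives the algebraic relation
`shapeMatrix_codazzi` and the evolution of the other entries. If `λ ≠ 0`, the algebraic relations
force the lower block to be `-u (l, n) ⊗ (l, n) / λ²`, so the Hamiltonian is `-4 (λ² + u²)` with `u
= λ tan y`. If `λ = 0`, then `u` and the lower block all scale by `1 / (1 - u₀ 𝓑)`, and the
Hamiltonian, being quadratic, by its square. -/

namespace ParallelSpinor

/-! ### Scalar ODEs on an open interval. -/

section ODE

variable {J : Set ℝ}

/-- The integral function of a continuous function on an open interval is a primitive of it. -/
theorem hasDerivAt_integral_of_continuousOn (hJ : IsOpen J) (hc : J.OrdConnected)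
    (h0 : (0 : ℝ) ∈ J) {g : ℝ → ℝ} (hg : ContinuousOn g J) {t : ℝ} (ht : t ∈ J) :
    HasDerivAt (fun s => ∫ τ in (0 : ℝ)..s, g τ) (g t) t :=
  intervalIntegral.integral_hasDerivAt_right
    ((hg.mono (hc.uIcc_subset h0 ht)).intervalIntegrable)
    (hg.stronglyMeasurableAtFilter hJ t ht) (hg.continuousAt (hJ.mem_nhds ht))

/-- A function with vanishing derivative on an open interval is constant there. -/
theorem eq_of_hasDerivAt_zero (hJ : IsOpen J) (hc : J.OrdConnected) {f : ℝ → ℝ}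
    (hf : ∀ t ∈ J, HasDerivAt f 0 t) {s t : ℝ} (hs : s ∈ J) (ht : t ∈ J) : f s = f t :=
  hJ.is_const_of_deriv_eq_zero hc.isPreconnected
    (fun x hx => (hf x hx).differentiableAt.differentiableWithinAt)
    (fun x hx => (hf x hx).deriv) hs ht

/-- A solution of a linear homogeneous equation that vanishes at `0` vanishes. -/
theorem eq_zero_of_hasDerivAt_mul (hJ : IsOpen J) (hc : J.OrdConnected) (h0 : (0 : ℝ) ∈ J)
    {g z : ℝ → ℝ} (hg : ContinuousOn g J) (hz : ∀ t ∈ J, HasDerivAt z (g t * z t) t)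
    (hz0 : z 0 = 0) {t : ℝ} (ht : t ∈ J) : z t = 0 := by
  -- Integrating factor.
  have key : ∀ s ∈ J, HasDerivAt (fun s => z s * Real.exp (-∫ τ in (0 : ℝ)..s, g τ)) 0 s := by
    intro s hs
    have h := (hz s hs).mul (hasDerivAt_integral_of_continuousOn hJ hc h0 hg hs).neg.exp
    refine h.congr_deriv ?_
    ring
  have h := eq_of_hasDerivAt_zero hJ hc key ht h0
  simpa [hz0, Real.exp_ne_zero] using h

variable {β u : ℝ → ℝ}

/-- The solution of `u' = β u²`. -/
theorem riccati_zero (hJ : IsOpen J) (hc : J.OrdConnected) (h0 : (0 : ℝ) ∈ J)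
    (hβ : ContinuousOn β J) (hu : ∀ t ∈ J, HasDerivAt u (β t * u t ^ 2) t) {t : ℝ} (ht : t ∈ J) :
    0 < 1 - u 0 * bint β t ∧ u t * (1 - u 0 * bint β t) = u 0 := by
  have hB : ∀ t ∈ J, HasDerivAt (fun s => 1 - u 0 * bint β s) (-(u 0 * β t)) t := fun t ht => by
    simpa [bint] using ((hasDerivAt_integral_of_continuousOn hJ hc h0 hβ ht).const_mul (u 0)).const_sub 1
  have hB0 : bint β 0 = 0 := by simp [bint]
  -- The defect `z = u (1 - u₀ 𝓑) - u₀` solves the linear equation `z' = β u z` with `z 0 = 0`; this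
  -- avoids dividing by `u` or by `1 - u₀ 𝓑`.
  have hprod : ∀ t ∈ J, u t * (1 - u 0 * bint β t) - u 0 = 0 := fun t ht => by
    refine eq_zero_of_hasDerivAt_mul (g := fun t => β t * u t)
      (z := fun t => u t * (1 - u 0 * bint β t) - u 0) hJ hc h0
      (hβ.mul fun s hs => (hu s hs).continuousAt.continuousWithinAt) (fun s hs => ?_)
      (by simp [hB0]) ht
    refine (((hu s hs).mul (hB s hs)).sub_const (u 0)).congr_deriv ?_
    ring
  refine ⟨?_, by linarith [hprod t ht]⟩
  -- Otherwise `1 - u₀ 𝓑` has a zero by the intermediate value theorem; there the product identity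
  -- forces `u₀ = 0`, which makes the factor equal to `1`.
  by_contra! hneg
  have hcont : ContinuousOn (fun s => 1 - u 0 * bint β s) J :=
    fun s hs => (hB s hs).continuousAt.continuousWithinAt
  obtain ⟨s, hs, hs0⟩ := hc.isPreconnected.intermediate_value ht h0 hcont
    (show (0 : ℝ) ∈ Set.Icc _ _ from ⟨hneg, by simp [hB0]⟩)
  simp only at hs0
  have h := hprod s hs
  rw [hs0] at h
  have hu0 : u 0 = 0 := by linarith
  simp [hu0] at hs0

/-- The solution of `u' = β (u² + μ²)`. -/
theorem riccati_pos (hJ : IsOpen J) (hc : J.OrdConnected) (h0 : (0 : ℝ) ∈ J)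
    (hβ : ContinuousOn β J) {μ : ℝ} (hμ : μ ≠ 0)
    (hu : ∀ t ∈ J, HasDerivAt u (β t * (u t ^ 2 + μ ^ 2)) t) {t : ℝ} (ht : t ∈ J) :
    μ * bint β t + Real.arctan (u 0 / μ) = Real.arctan (u t / μ) := by
  have key : ∀ s ∈ J, HasDerivAt (fun s => μ * bint β s - Real.arctan (u s / μ)) 0 s := by
    intro s hs
    have h := ((hasDerivAt_integral_of_continuousOn hJ hc h0 hβ hs).const_mul μ).sub
      ((hu s hs).div_const μ).arctan
    refine h.congr_deriv ?_
    have : 1 + (u s / μ) ^ 2 ≠ 0 := by positivity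
    have : μ ^ 2 + u s ^ 2 ≠ 0 := by positivity
    field_simp
    ring
  have h := eq_of_hasDerivAt_zero hJ hc key ht h0
  simp only [bint, intervalIntegral.integral_same] at h ⊢
  linarith

end ODE

/-! ### Curvature of a frame with constant structure coefficients. -/

section Frame

variable {M : Type*} [TopologicalSpace M] [ChartedSpace (EuclideanSpace ℝ (Fin 3)) M]

/-- The vector field with constant components `v` in the frame dual to `e`. -/
noncomputable def constField (e : Coframe M) (v : Fin 3 → ℝ) : VField M :=
  fun p => (e p).symm v

theorem frame_eq_constField (e : Coframe M) (a : Fin 3) :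
    frame e a = constField e (Pi.single a 1) := rfl

@[simp]
theorem form_constField (e : Coframe M) (a : Fin 3) (v : Fin 3 → ℝ) (p : M) :
    form e a p (constField e v p) = v a := by
  simp [form, constField]

theorem metric_constField (e : Coframe M) (v w : Fin 3 → ℝ) (p : M) :
    metric e p (constField e v p) (constField e w p) = v ⬝ᵥ w := by
  simp [metric, dotProduct]

theorem dirDeriv_const (X : VField M) (c : ℝ) (p : M) : dirDeriv X (fun _ => c) p = 0 := by
  rw [dirDeriv, mvfderiv_const]
  rfl

variable {e : Coframe M} {br : (Fin 3 → ℝ) → (Fin 3 → ℝ) → Fin 3 → ℝ}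

/-- The algebraic Levi-Civita connection of a metric Lie bracket on `ℝ³`. -/
noncomputable def algConnection (br : (Fin 3 → ℝ) → (Fin 3 → ℝ) → Fin 3 → ℝ)
    (v w : Fin 3 → ℝ) : Fin 3 → ℝ :=
  fun a => (1 / 2 : ℝ) * (br v w a - br v (Pi.single a 1) ⬝ᵥ w - br w (Pi.single a 1) ⬝ᵥ v)

/-- Metric products of constant-component fields are constant, so only the bracket terms of the
Koszul expression survive. -/
theorem leviCivita_constField
    (hbr : ∀ v w, VectorField.mlieBracket (𝓡 3) (constField e v) (constField e w) =
      constField e (br v w)) (v w : Fin 3 → ℝ) :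
    leviCivita e (constField e v) (constField e w) = constField e (algConnection br v w) := by
  funext p
  have h : ∀ a, (1 / 2 : ℝ) * koszul e (constField e v) (constField e w) (frame e a) p =
      algConnection br v w a := by
    intro a
    simp only [koszul, frame_eq_constField, hbr, metric_constField, dirDeriv_const, algConnection]
    simp
  simp only [leviCivita, h]
  simp only [frame, constField]
  conv_rhs => rw [pi_eq_sum_univ' (algConnection br v w)]
  simp [map_sum]

/-- The scalar curvature of a frame whose brackets have constant components. -/
theorem scalarCurvature_of_bracket
    (hbr : ∀ v w, VectorField.mlieBracket (𝓡 3) (constField e v) (constField e w) =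
      constField e (br v w)) (p : M) :
    scalarCurvature e p = ∑ a, ∑ b,
      (algConnection br (Pi.single a 1) (algConnection br (Pi.single b 1) (Pi.single b 1))
        - algConnection br (Pi.single b 1) (algConnection br (Pi.single a 1) (Pi.single b 1))
        - algConnection br (br (Pi.single a 1) (Pi.single b 1)) (Pi.single b 1)) a := by
  refine Finset.sum_congr rfl fun a _ => Finset.sum_congr rfl fun b _ => ?_
  simp only [curvature, frame_eq_constField, leviCivita_constField hbr, hbr]
  have h : ∀ x y z : Fin 3 → ℝ, constField e x p - constField e y p - constField e z p =
      constField e (x - y - z) p := by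
    intro x y z
    simp [constField]
  rw [h, metric_constField]
  simp

/-- The bracket of the frame dual to a coframe with `d e_a = T(e_a) ∧ e_u`. -/
def shapeBracket (T : Fin 3 → Fin 3 → ℝ) (v w : Fin 3 → ℝ) : Fin 3 → ℝ :=
  fun a => (∑ b, T a b * w b) * v 0 - (∑ b, T a b * v b) * w 0

theorem scalarCurvature_of_shapeBracket {T : Fin 3 → Fin 3 → ℝ} (hT : ∀ a b, T a b = T b a)
    (hbr : ∀ v w, VectorField.mlieBracket (𝓡 3) (constField e v) (constField e w) =
      constField e (shapeBracket T v w)) (p : M) :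
    scalarCurvature e p =
      -2 * (T 0 1 ^ 2 + T 0 2 ^ 2 + T 1 1 ^ 2 + T 2 2 ^ 2 + T 1 2 ^ 2 + T 1 1 * T 2 2) := by
  rw [scalarCurvature_of_bracket hbr]
  simp only [Fin.sum_univ_three, Pi.sub_apply, algConnection, shapeBracket, dotProduct]
  simp
  rw [hT 1 0, hT 2 0, hT 2 1]
  ring

end Frame

/-! ### Left-invariant fields and forms. -/

section LeftInvariant

open Bundle

variable {G : Type*} [TopologicalSpace G] [ChartedSpace (EuclideanSpace ℝ (Fin 3)) G] [Group G]

theorem IsLeftInvariant.mfderiv_constField {e : Coframe G} (he : IsLeftInvariant e) (g p : G)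
    (v : Fin 3 → ℝ) :
    mfderiv (𝓡 3) (𝓡 3) (fun x : G => g * x) p (constField e v p) = constField e v (g * p) := by
  refine (e (g * p)).injective ((he g p _).trans ?_)
  simp [constField]

/-- Makes these fields independent of the coframe: a field with constant components in one
left-invariant coframe has constant components in any other. -/
theorem IsLeftInvariant.constField_eq {e : Coframe G} (he : IsLeftInvariant e)
    (v : Fin 3 → ℝ) :
    constField e v = mulInvariantVectorField (I := 𝓡 3) (constField e v 1) := by
  funext g
  have h := he.mfderiv_constField g 1 v
  rw [mulInvariantVectorField]
  -- Tangent spaces at `g * 1` and `g` are both the model space, which lets the equation be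
  -- transported along `mul_one`.
  have h1 : ∀ q : G, q = g → (constField e v q : EuclideanSpace ℝ (Fin 3)) = constField e v g := by
    rintro q rfl; rfl
  exact (h.trans (h1 _ (mul_one g))).symm

theorem IsLeftInvariant.apply_mulInvariantVectorField {e : Coframe G} (he : IsLeftInvariant e)
    (v : TangentSpace (𝓡 3) (1 : G)) (g : G) :
    e g (mulInvariantVectorField (I := 𝓡 3) v g) = e 1 v := by
  have h : v = constField e (e 1 v) 1 := by simp [constField]
  have h2 := congrFun (he.constField_eq (e 1 v)) g
  rw [← h] at h2
  rw [← h2]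
  simp [constField]

theorem IsLeftInvariant.extD_form {e : Coframe G} (he : IsLeftInvariant e)
    (a : Fin 3) (v w : TangentSpace (𝓡 3) (1 : G)) (p : G) :
    extD (form e a) (mulInvariantVectorField (I := 𝓡 3) v) (mulInvariantVectorField (I := 𝓡 3) w) p
      = - form e a p (VectorField.mlieBracket (𝓡 3) (mulInvariantVectorField v)
          (mulInvariantVectorField w) p) := by
  simp only [extD, form, he.apply_mulInvariantVectorField, dirDeriv_const]
  ring

variable [LieGroup (𝓡 3) ∞ G]

instance : LieGroup (𝓡 3) (minSmoothness ℝ 3) G :=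
  LieGroup.of_le (n := ∞) (by simpa using ENat.LEInfty.out (m := 3))

/-- Left-invariant vector fields on a smooth Lie group are smooth. -/
theorem isSmoothField_mulInvariantVectorField (v : TangentSpace (𝓡 3) (1 : G)) :
    IsSmoothField (mulInvariantVectorField (I := 𝓡 3) v : VField G) := by
  have sfg : ContMDiff (𝓡 3) (𝓡 3).tangent ∞
      (fun g : G => (TotalSpace.mk' (EuclideanSpace ℝ (Fin 3)) g 0 : TangentBundle (𝓡 3) G)) :=
    contMDiff_zeroSection _ _
  have sfv : ContMDiff (𝓡 3) (𝓡 3).tangent ∞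
      (fun _ : G => (TotalSpace.mk' (EuclideanSpace ℝ (Fin 3)) 1 v : TangentBundle (𝓡 3) G)) :=
    contMDiff_const
  have S₂ : ContMDiff ((𝓡 3).tangent.prod (𝓡 3).tangent) ((𝓡 3).prod (𝓡 3)).tangent ∞
      (equivTangentBundleProd (𝓡 3) G (𝓡 3) G).symm := contMDiff_equivTangentBundleProd_symm
  have S₃ : ContMDiff ((𝓡 3).prod (𝓡 3)).tangent (𝓡 3).tangent ∞
      (tangentMap ((𝓡 3).prod (𝓡 3)) (𝓡 3) (fun p : G × G => p.1 * p.2)) :=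
    ContMDiff.contMDiff_tangentMap (contMDiff_mul (𝓡 3) ∞) (m := ∞) (by simp)
  have S := (S₃.comp S₂).comp (sfg.prodMk sfv)
  rw [IsSmoothField]
  convert! S with g
  · simp
  · simp only [Function.comp_apply, tangentMap]
    -- The differential of multiplication splits into two partial differentials; the first is
    -- applied to the zero vector.
    rw [mfderiv_prod_eq_add_apply ((contMDiff_mul (𝓡 3) ∞).mdifferentiableAt (by simp))]
    change mfderiv (𝓡 3) (𝓡 3) (fun x : G => g * x) 1 v =
      mfderiv (𝓡 3) (𝓡 3) (fun z : G => z * 1) g 0 +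
        mfderiv (𝓡 3) (𝓡 3) (fun z : G => g * z) 1 v
    have h : mfderiv (𝓡 3) (𝓡 3) (fun z : G => z * 1) g 0 = 0 := map_zero _
    exact ((congrArg (· + mfderiv (𝓡 3) (𝓡 3) (fun z : G => g * z) 1 v) h).trans
      (zero_add _)).symm

theorem IsLeftInvariant.isSmoothField_constField {e : Coframe G} (he : IsLeftInvariant e)
    (v : Fin 3 → ℝ) : IsSmoothField (constField e v) := by
  rw [he.constField_eq]
  exact isSmoothField_mulInvariantVectorField _

end LeftInvariant

/-! ### The ODE system for the shape matrix. -/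

section Flow

variable {G : Type*} [TopologicalSpace G] [ChartedSpace (EuclideanSpace ℝ (Fin 3)) G]

theorem shapeComp_symm (β : ℝ → ℝ) (e : ℝ → Coframe G) (t : ℝ) (a b : Fin 3) (p : G) :
    shapeComp β e t a b p = shapeComp β e t b a p := by
  simp only [shapeComp, shape, metric, mul_comm]

variable [Group G]

/-- The matrix of components of the shape operator at the identity. -/
noncomputable def shapeMatrix (β : ℝ → ℝ) (e : ℝ → Coframe G) (t : ℝ) : Matrix (Fin 3) (Fin 3) ℝ :=
  fun a b => shapeComp β e t a b 1

theorem shapeMatrix_symm (β : ℝ → ℝ) (e : ℝ → Coframe G) (t : ℝ) (a b : Fin 3) :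
    shapeMatrix β e t a b = shapeMatrix β e t b a :=
  shapeComp_symm β e t a b 1

variable [LieGroup (𝓡 3) ∞ G] {J : Set ℝ} {β : ℝ → ℝ} {e : ℝ → Coframe G}

namespace IsLeftInvariantFlow

/-- The frame at time `t` has position-independent components in the coframe at any nearby time `s`,
so the functions differentiated at `p` and at `1` agree near `t`. -/
theorem shapeComp_eq (h : IsLeftInvariantFlow J β e) {t : ℝ} (ht : t ∈ J) (a b : Fin 3) (p : G) :
    shapeComp β e t a b p = shapeMatrix β e t a b := by
  simp only [shapeMatrix, shapeComp, shape, frame_eq_constField]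
  congr 1
  refine Filter.EventuallyEq.deriv_eq ?_
  filter_upwards [h.isOpen.mem_nhds ht] with s hs
  have key : ∀ c, e s p (constField (e t) c p) = e s 1 (constField (e t) c 1) := by
    intro c
    rw [congrFun ((h.leftInvariant t ht).constField_eq c) p,
      (h.leftInvariant s hs).apply_mulInvariantVectorField]
  simp only [metric, form, key]

theorem hasDerivAt_form (h : IsLeftInvariantFlow J β e) {t : ℝ} (ht : t ∈ J) (a : Fin 3) (p : G)
    (v : TangentSpace (𝓡 3) p) :
    HasDerivAt (fun s => form (e s) a p v) (-(β t * shapeForm β e t a p v)) t := by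
  have hd : DifferentiableAt ℝ (fun s => form (e s) a p v) t :=
    ((h.smooth_coframe p v a).contDiffAt (h.isOpen.mem_nhds ht)).differentiableAt (by simp)
  refine hd.hasDerivAt.congr_deriv ?_
  linarith [h.evolution t ht a p v]

theorem differentiableAt_shapeForm (h : IsLeftInvariantFlow J β e) {t : ℝ} (ht : t ∈ J)
    (a : Fin 3) (p : G) (v : TangentSpace (𝓡 3) p) :
    DifferentiableAt ℝ (fun s => shapeForm β e s a p v) t := by
  have hd : DifferentiableAt ℝ (fun s => -deriv (fun r => form (e r) a p v) s / β s) t := by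
    refine DifferentiableAt.div ?_ ?_ (h.beta_ne_zero t ht)
    · have hc := (h.smooth_coframe p v a).deriv_of_isOpen (m := ∞) h.isOpen (by simp)
      exact ((hc.contDiffAt (h.isOpen.mem_nhds ht)).differentiableAt (by simp)).neg
    · exact (h.smooth_beta.contDiffAt (h.isOpen.mem_nhds ht)).differentiableAt (by simp)
  refine hd.congr_of_eventuallyEq ?_
  filter_upwards [h.isOpen.mem_nhds ht] with s hs
  have hb := h.beta_ne_zero s hs
  rw [eq_div_iff hb]
  linarith [h.evolution s hs a p v]

/-- Linearity in the vector is not immediate from the definition through `deriv`; it comes from the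
evolution equation, which makes `Θ_t(e_a)` a multiple of the time derivative of linear forms. -/
theorem shapeForm_constField (h : IsLeftInvariantFlow J β e) {t : ℝ} (ht : t ∈ J)
    (a : Fin 3) (p : G) (v : Fin 3 → ℝ) :
    shapeForm β e t a p (constField (e t) v p) = ∑ b, shapeMatrix β e t a b * v b := by
  have h1 := h.hasDerivAt_form ht a p (constField (e t) v p)
  have h2 : HasDerivAt (fun s => ∑ b, form (e s) a p (frame (e t) b p) * v b)
      (∑ b, -(β t * shapeForm β e t a p (frame (e t) b p)) * v b) t :=
    HasDerivAt.fun_sum fun b _ => (h.hasDerivAt_form ht a p (frame (e t) b p)).mul_const (v b)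
  have h3 : (fun s => form (e s) a p (constField (e t) v p)) =
      fun s => ∑ b, form (e s) a p (frame (e t) b p) * v b := by
    funext s
    have hv : constField (e t) v p = ∑ b, v b • frame (e t) b p := by
      simp only [constField, frame]
      conv_lhs => rw [pi_eq_sum_univ' v]
      simp [map_sum]
    simp [hv, form, map_sum, mul_comm]
  rw [h3] at h1
  have h4 := h1.unique h2
  have hb := h.beta_ne_zero t ht
  have h5 : ∀ b, shapeForm β e t a p (frame (e t) b p) = shapeMatrix β e t a b :=
    fun b => h.shapeComp_eq ht a b p
  simp only [h5] at h4
  apply mul_left_cancel₀ hb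
  rw [Finset.mul_sum]
  simp only [neg_mul, Finset.sum_neg_distrib, neg_inj, mul_assoc] at h4
  exact h4

theorem shapeForm_one (h : IsLeftInvariantFlow J β e) {t : ℝ} (ht : t ∈ J)
    (a : Fin 3) (v : TangentSpace (𝓡 3) (1 : G)) :
    shapeForm β e t a 1 v = ∑ b, shapeMatrix β e t a b * e t 1 v b := by
  rw [← h.shapeForm_constField ht a 1 (e t 1 v)]
  simp [constField]

/-- On left-invariant fields `dη(X, Y) = -η([X, Y])`, so the structure equation reads off every
component of the bracket. -/
theorem form_bracket (h : IsLeftInvariantFlow J β e) {t : ℝ} (ht : t ∈ J) (v w : Fin 3 → ℝ) :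
    VectorField.mlieBracket (𝓡 3) (constField (e t) v) (constField (e t) w) =
      constField (e t) (shapeBracket (shapeMatrix β e t) v w) := by
  have he := h.leftInvariant t ht
  funext p
  refine (e t p).injective (funext fun a => ?_)
  have h1 := h.structureEq t ht a _ _ (he.isSmoothField_constField v)
    (he.isSmoothField_constField w) p
  simp only [wedge, h.shapeForm_constField ht, form_constField] at h1
  rw [he.constField_eq v, he.constField_eq w, he.extD_form, ← he.constField_eq v,
    ← he.constField_eq w] at h1
  simp only [constField, ContinuousLinearEquiv.apply_symm_apply, shapeBracket, form] at h1 ⊢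
  linarith

/-- The form `Θ_t(e_u)` is closed. -/
theorem shapeMatrix_closed (h : IsLeftInvariantFlow J β e) {t : ℝ} (ht : t ∈ J) {b : Fin 3}
    (hb : b ≠ 0) : ∑ a, shapeMatrix β e t 0 a * shapeMatrix β e t a b = 0 := by
  have he := h.leftInvariant t ht
  have h1 := h.shape_u_closed t ht _ _ (he.isSmoothField_constField (Pi.single 0 1))
    (he.isSmoothField_constField (Pi.single b 1)) 1
  simp only [extD, h.form_bracket ht, h.shapeForm_constField ht, dirDeriv_const] at h1
  simpa [shapeBracket, hb, Pi.single_apply, hb.symm] using h1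

theorem shapeForm_zero_const (h : IsLeftInvariantFlow J β e) {s t : ℝ} (hs : s ∈ J) (ht : t ∈ J)
    (p : G) (v : TangentSpace (𝓡 3) p) : shapeForm β e s 0 p v = shapeForm β e t 0 p v :=
  eq_of_hasDerivAt_zero h.isOpen h.ordConnected (f := fun s => shapeForm β e s 0 p v)
    (fun r hr => (h.differentiableAt_shapeForm hr 0 p v).hasDerivAt.congr_deriv
      (h.shape_u_const r hr p v)) hs ht

theorem hasDerivAt_coframe_one (h : IsLeftInvariantFlow J β e) {t : ℝ} (ht : t ∈ J) (a : Fin 3)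
    (v : TangentSpace (𝓡 3) (1 : G)) :
    HasDerivAt (fun s => e s 1 v a) (-(β t * ∑ b, shapeMatrix β e t a b * e t 1 v b)) t := by
  rw [← h.shapeForm_one ht]
  exact h.hasDerivAt_form ht a 1 v

theorem differentiableAt_shapeMatrix (h : IsLeftInvariantFlow J β e) {t : ℝ} (ht : t ∈ J)
    (a b : Fin 3) : DifferentiableAt ℝ (fun s => shapeMatrix β e s a b) t := by
  let E : Fin 3 → TangentSpace (𝓡 3) (1 : G) := fun c => frame (e t) c 1
  -- With the frame frozen at time `t`, `S = T A` and `A t = 1`; hence `T = S · adj A / det A` near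
  -- `t`, where `S` and `A` are differentiable.
  let A : ℝ → Matrix (Fin 3) (Fin 3) ℝ := fun s => Matrix.of fun c d => e s 1 (E d) c
  let S : ℝ → Matrix (Fin 3) (Fin 3) ℝ := fun s => Matrix.of fun c d => shapeForm β e s c 1 (E d)
  have hA : ∀ c d, DifferentiableAt ℝ (fun s => A s c d) t := fun c d =>
    (h.hasDerivAt_coframe_one ht c (E d)).differentiableAt
  have hS : ∀ c d, DifferentiableAt ℝ (fun s => S s c d) t := fun c d =>
    h.differentiableAt_shapeForm ht c 1 (E d)
  have hdet : DifferentiableAt ℝ (fun s => (A s).det) t := by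
    simp only [Matrix.det_fin_three]
    fun_prop
  have hAt : A t = 1 := by
    ext c d
    simp [A, E, frame, Matrix.one_apply, Pi.single_apply]
  have hadj : ∀ c d, DifferentiableAt ℝ (fun s => (A s).adjugate c d) t := by
    intro c d
    simp only [Matrix.adjugate_fin_three]
    fin_cases c <;> fin_cases d <;> simp <;> fun_prop
  have hdet0 : (A t).det ≠ 0 := by simp [hAt]
  have key : DifferentiableAt ℝ (fun s => (∑ c, S s a c * (A s).adjugate c b) / (A s).det) t :=
    (DifferentiableAt.fun_sum fun c _ => (hS a c).mul (hadj c b)).div hdet hdet0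
  refine key.congr_of_eventuallyEq ?_
  filter_upwards [h.isOpen.mem_nhds ht, hdet.continuousAt.eventually_ne hdet0] with s hs hs0
  rw [eq_div_iff hs0]
  have hSA : S s = shapeMatrix β e s * A s := by
    ext c d
    simp [S, A, Matrix.mul_apply, h.shapeForm_one hs]
  rw [← Matrix.mul_apply, hSA, Matrix.mul_assoc, Matrix.mul_adjugate]
  simp [mul_comm]

/-- The evolution of `Θ_ub`. -/
theorem hasDerivAt_shapeMatrix_zero (h : IsLeftInvariantFlow J β e) {t : ℝ} (ht : t ∈ J)
    (b : Fin 3) : HasDerivAt (fun s => shapeMatrix β e s 0 b)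
      (β t * ∑ a, shapeMatrix β e t 0 a * shapeMatrix β e t a b) t := by
  have hd := h.differentiableAt_shapeMatrix ht 0
  have h1 : HasDerivAt (fun s => ∑ a, shapeMatrix β e s 0 a * e s 1 (frame (e t) b 1) a) _ t :=
    HasDerivAt.fun_sum fun a _ =>
      (hd a).hasDerivAt.mul (h.hasDerivAt_coframe_one ht a (frame (e t) b 1))
  have h2 : HasDerivAt (fun s => ∑ a, shapeMatrix β e s 0 a * e s 1 (frame (e t) b 1) a) 0 t := by
    refine (hasDerivAt_const t (shapeForm β e t 0 1 (frame (e t) b 1))).congr_of_eventuallyEq ?_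
    filter_upwards [h.isOpen.mem_nhds ht] with s hs
    rw [← h.shapeForm_one hs, h.shapeForm_zero_const hs ht]
  have h3 := h1.unique h2
  refine (hd b).hasDerivAt.congr_deriv ?_
  simp [frame, Finset.sum_add_distrib, Pi.single_apply] at h3
  simp only [Finset.mul_sum]
  refine (eq_of_sub_eq_zero ?_)
  rw [← h3, sub_eq_add_neg, ← Finset.sum_neg_distrib, ← Finset.sum_neg_distrib]
  congr 1
  exact Finset.sum_congr rfl fun a _ => by ring

/-- The derivative of the structure equation in time. -/
theorem deriv_structure (h : IsLeftInvariantFlow J β e) {t : ℝ} (ht : t ∈ J)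
    (a c d : Fin 3) :
    -(β t * ∑ b, shapeMatrix β e t a b *
        shapeBracket (shapeMatrix β e t) (Pi.single c 1) (Pi.single d 1) b) =
      ((deriv (fun s => shapeMatrix β e s a d) t
          - β t * ∑ b, shapeMatrix β e t a b * shapeMatrix β e t b d) * (Pi.single c 1 : Fin 3 → ℝ) 0
        - shapeMatrix β e t a d * (β t * shapeMatrix β e t 0 c))
      - ((deriv (fun s => shapeMatrix β e s a c) t
          - β t * ∑ b, shapeMatrix β e t a b * shapeMatrix β e t b c) * (Pi.single d 1 : Fin 3 → ℝ) 0
        - shapeMatrix β e t a c * (β t * shapeMatrix β e t 0 d)) := by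
  have hd := h.differentiableAt_shapeMatrix ht a
  -- The fields and their bracket are frozen at time `t`; only the coframe evaluated on them varies
  -- with `s`.
  let κ := VectorField.mlieBracket (𝓡 3) (constField (e t) (Pi.single c 1))
    (constField (e t) (Pi.single d 1)) 1
  have hκ : e t 1 κ = shapeBracket (shapeMatrix β e t) (Pi.single c 1) (Pi.single d 1) := by
    simp only [κ, h.form_bracket ht]
    simp [constField]
  have hE : ∀ c, HasDerivAt (fun s => ∑ b, shapeMatrix β e s a b * e s 1 (frame (e t) c 1) b)
      (deriv (fun s => shapeMatrix β e s a c) t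
          - β t * ∑ b, shapeMatrix β e t a b * shapeMatrix β e t b c) t := by
    intro c
    have h1 : HasDerivAt (fun s => ∑ b, shapeMatrix β e s a b * e s 1 (frame (e t) c 1) b) _ t :=
      HasDerivAt.fun_sum fun b _ =>
        (hd b).hasDerivAt.mul (h.hasDerivAt_coframe_one ht b (frame (e t) c 1))
    refine h1.congr_deriv ?_
    simp only [Finset.sum_add_distrib, Finset.mul_sum, sub_eq_add_neg, ← Finset.sum_neg_distrib]
    simp only [frame, ContinuousLinearEquiv.apply_symm_apply, Pi.single_apply]
    simp
    exact Finset.sum_congr rfl fun a _ => by ring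
  have h0 := fun c => h.hasDerivAt_coframe_one ht 0 (frame (e t) c 1)
  have hL := h.hasDerivAt_coframe_one ht a κ
  have hR := ((hE d).mul (h0 c)).sub ((hE c).mul (h0 d))
  -- The structure equation at time `s`, evaluated on the frozen fields, which have constant
  -- components in the coframe at time `s` too.
  have heq : (fun s => e s 1 κ a) =ᶠ[nhds t]
      ((fun s => ∑ b, shapeMatrix β e s a b * e s 1 (frame (e t) d 1) b) *
        fun s => e s 1 (frame (e t) c 1) 0) -
      ((fun s => ∑ b, shapeMatrix β e s a b * e s 1 (frame (e t) c 1) b) *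
        fun s => e s 1 (frame (e t) d 1) 0) := by
    filter_upwards [h.isOpen.mem_nhds ht] with s hs
    have ht' := h.leftInvariant t ht
    have hs' := h.leftInvariant s hs
    have hsw : ∀ c, constField (e t) (Pi.single c 1) =
        constField (e s) (e s 1 (frame (e t) c 1)) := by
      intro c
      rw [ht'.constField_eq, hs'.constField_eq]
      congr 1
      simp [constField, frame]
    simp only [κ, hsw, h.form_bracket hs]
    simp [constField, shapeBracket]
  have hfin := (hL.congr_of_eventuallyEq heq.symm).unique hR
  rw [hκ] at hfin
  rw [hfin]
  simp [frame, Pi.single_apply]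
  ring

end IsLeftInvariantFlow
end Flow

/-! ### Conserved quantities and the Hamiltonian. -/

section Hamiltonian

variable {G : Type*} [TopologicalSpace G] [ChartedSpace (EuclideanSpace ℝ (Fin 3)) G]
  [Group G] [LieGroup (𝓡 3) ∞ G] {J : Set ℝ} {β : ℝ → ℝ} {e : ℝ → Coframe G}

namespace IsLeftInvariantFlow

/-- The relation obtained from the evolution of the integrable plane field `e_u = 0`. -/
theorem shapeMatrix_codazzi (h : IsLeftInvariantFlow J β e) {t : ℝ} (ht : t ∈ J) (a : Fin 3) :
    shapeMatrix β e t a 1 * shapeMatrix β e t 0 2 =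
      shapeMatrix β e t a 2 * shapeMatrix β e t 0 1 := by
  -- The fields `E_l` and `E_n` commute and are killed by `e_u`, so no time derivative of `T`
  -- enters.
  have h1 := h.deriv_structure ht a 1 2
  simp [shapeBracket] at h1
  refine mul_left_cancel₀ (h.beta_ne_zero t ht) ?_
  linarith

/-- The pair `(E_u, E_b)` in the differentiated structure equation; the `T²` terms on the two sides
cancel. -/
theorem hasDerivAt_shapeMatrix (h : IsLeftInvariantFlow J β e) {t : ℝ} (ht : t ∈ J)
    (a : Fin 3) {b : Fin 3} (hb : b ≠ 0) :
    HasDerivAt (fun s => shapeMatrix β e s a b)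
      (β t * (shapeMatrix β e t a b * shapeMatrix β e t 0 0
        - shapeMatrix β e t a 0 * shapeMatrix β e t 0 b)) t := by
  refine (h.differentiableAt_shapeMatrix ht a b).hasDerivAt.congr_deriv ?_
  have h1 := h.deriv_structure ht a 0 b
  simp [shapeBracket, hb.symm, Pi.single_apply] at h1
  linarith

theorem shapeMatrix_zero_const (h : IsLeftInvariantFlow J β e) {t : ℝ} (ht : t ∈ J)
    {b : Fin 3} (hb : b ≠ 0) : shapeMatrix β e t 0 b = shapeMatrix β e 0 0 b :=
  eq_of_hasDerivAt_zero h.isOpen h.ordConnected (f := fun s => shapeMatrix β e s 0 b)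
    (fun r hr => (h.hasDerivAt_shapeMatrix_zero hr b).congr_deriv
      (by rw [h.shapeMatrix_closed hr hb, mul_zero])) ht h.zero_mem

theorem hamiltonian_eq (h : IsLeftInvariantFlow J β e) {t : ℝ} (ht : t ∈ J) (p : G) :
    hamiltonian β e t p =
      -4 * (shapeMatrix β e t 0 1 ^ 2 + shapeMatrix β e t 0 2 ^ 2)
      - 2 * (shapeMatrix β e t 1 1 ^ 2 + 2 * shapeMatrix β e t 1 2 ^ 2
        + shapeMatrix β e t 2 2 ^ 2)
      + 2 * shapeMatrix β e t 0 0 * (shapeMatrix β e t 1 1 + shapeMatrix β e t 2 2) := by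
  simp only [hamiltonian, scalarCurvature_of_shapeBracket (shapeMatrix_symm β e t)
    (h.form_bracket ht), h.shapeComp_eq ht, Fin.sum_univ_three]
  rw [shapeMatrix_symm β e t 1 0, shapeMatrix_symm β e t 2 0, shapeMatrix_symm β e t 2 1]
  ring

/-- The Hamiltonian function when `λ ≠ 0`. -/
theorem hamiltonian_eq_of_ne_zero (h : IsLeftInvariantFlow J β e) {t : ℝ} (ht : t ∈ J)
    (hl : shapeMatrix β e t 0 1 ^ 2 + shapeMatrix β e t 0 2 ^ 2 ≠ 0) (p : G) :
    hamiltonian β e t p = -4 * (shapeMatrix β e t 0 1 ^ 2 + shapeMatrix β e t 0 2 ^ 2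
      + shapeMatrix β e t 0 0 ^ 2) := by
  rw [h.hamiltonian_eq ht]
  have c1 := h.shapeMatrix_closed ht (b := 1) (by decide)
  have c2 := h.shapeMatrix_closed ht (b := 2) (by decide)
  have j1 := h.shapeMatrix_codazzi ht 1
  have j2 := h.shapeMatrix_codazzi ht 2
  simp only [Fin.sum_univ_three] at c1 c2
  rw [shapeMatrix_symm β e t 2 1] at c1 j2
  generalize shapeMatrix β e t 0 0 = u at *
  generalize shapeMatrix β e t 0 1 = l at *
  generalize shapeMatrix β e t 0 2 = n at *
  generalize shapeMatrix β e t 1 1 = a at *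
  generalize shapeMatrix β e t 1 2 = b at *
  generalize shapeMatrix β e t 2 2 = c at *
  -- Closedness and the Codazzi relation form a linear system for the lower block, solvable because
  -- `l² + n² ≠ 0`.
  have ha : a = -u * l ^ 2 / (l ^ 2 + n ^ 2) := by
    rw [eq_div_iff hl]; linear_combination l * c1 + n * j1
  have hb : b = -u * l * n / (l ^ 2 + n ^ 2) := by
    rw [eq_div_iff hl]; linear_combination l * c2 + n * j2
  have hc : c = -u * n ^ 2 / (l ^ 2 + n ^ 2) := by
    rw [eq_div_iff hl]; linear_combination n * c2 - l * j2
  rw [ha, hb, hc]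
  field_simp
  ring

theorem lam_sq (h : IsLeftInvariantFlow J β e) (p : G) :
    lam β e p ^ 2 = shapeMatrix β e 0 0 1 ^ 2 + shapeMatrix β e 0 0 2 ^ 2 := by
  rw [lam, Real.sq_sqrt (by positivity), h.shapeComp_eq h.zero_mem, h.shapeComp_eq h.zero_mem]

theorem lam_sq' (h : IsLeftInvariantFlow J β e) {t : ℝ} (ht : t ∈ J) (p : G) :
    lam β e p ^ 2 = shapeMatrix β e t 0 1 ^ 2 + shapeMatrix β e t 0 2 ^ 2 := by
  rw [h.lam_sq, h.shapeMatrix_zero_const ht (by decide), h.shapeMatrix_zero_const ht (by decide)]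

theorem hasDerivAt_shapeMatrix_zero_zero (h : IsLeftInvariantFlow J β e) (p : G) {t : ℝ}
    (ht : t ∈ J) : HasDerivAt (fun s => shapeMatrix β e s 0 0)
      (β t * (shapeMatrix β e t 0 0 ^ 2 + lam β e p ^ 2)) t := by
  refine (h.hasDerivAt_shapeMatrix_zero ht 0).congr_deriv ?_
  rw [h.lam_sq' ht, Fin.sum_univ_three, shapeMatrix_symm β e t 1 0, shapeMatrix_symm β e t 2 0]
  ring

/-- The Hamiltonian function along a flow with `λ = 0`. -/
theorem hamiltonian_of_lam_eq_zero (h : IsLeftInvariantFlow J β e) {p : G} (hl : lam β e p = 0)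
    {t : ℝ} (ht : t ∈ J) :
    0 < 1 - shapeComp β e 0 0 0 p * bint β t ∧
      hamiltonian β e t p =
        hamiltonian β e 0 p / (1 - shapeComp β e 0 0 0 p * bint β t) ^ 2 := by
  rw [h.shapeComp_eq h.zero_mem]
  have hβ := h.smooth_beta.continuousOn
  have hu : ∀ s ∈ J, HasDerivAt (fun s => shapeMatrix β e s 0 0)
      (β s * shapeMatrix β e s 0 0 ^ 2) s := fun s hs =>
    (h.hasDerivAt_shapeMatrix_zero_zero p hs).congr_deriv (by simp [hl])
  have hsol := fun {s : ℝ} => riccati_zero (t := s) h.isOpen h.ordConnected h.zero_mem hβ hu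
  have hln : ∀ s ∈ J, shapeMatrix β e s 0 1 = 0 ∧ shapeMatrix β e s 0 2 = 0 := fun s hs => by
    have h2 := h.lam_sq' hs p
    rw [hl] at h2
    constructor <;> nlinarith
  refine ⟨(hsol ht).1, ?_⟩
  rw [eq_div_iff (pow_ne_zero 2 (hsol ht).1.ne')]
  -- As `T₀j = 0`, the lower block satisfies `T_ij' = β u T_ij`, while `1 - u₀ 𝓑` has logarithmic
  -- derivative `-β u`.
  have hlow : ∀ i j : Fin 3, i ≠ 0 → j ≠ 0 → ∀ s ∈ J,
      shapeMatrix β e s i j * (1 - shapeMatrix β e 0 0 0 * bint β s) = shapeMatrix β e 0 i j := by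
    intro i j hi hj s hs
    have key : ∀ s ∈ J, HasDerivAt
        (fun s => shapeMatrix β e s i j * (1 - shapeMatrix β e 0 0 0 * bint β s)) 0 s := by
      intro s hs
      have hB := ((hasDerivAt_integral_of_continuousOn h.isOpen h.ordConnected h.zero_mem hβ
        hs).const_mul (shapeMatrix β e 0 0 0)).const_sub 1
      refine ((h.hasDerivAt_shapeMatrix hs i hj).mul hB).congr_deriv ?_
      have hj0 : shapeMatrix β e s 0 j = 0 := by
        fin_cases j
        exacts [absurd rfl hj, (hln s hs).1, (hln s hs).2]
      have h3 := (hsol hs).2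
      rw [bint] at h3
      rw [hj0]
      linear_combination β s * shapeMatrix β e s i j * h3
    have h4 := eq_of_hasDerivAt_zero h.isOpen h.ordConnected key hs h.zero_mem
    simpa [bint] using h4
  rw [h.hamiltonian_eq ht, h.hamiltonian_eq h.zero_mem, (hln t ht).1, (hln t ht).2,
    (hln 0 h.zero_mem).1, (hln 0 h.zero_mem).2]
  rw [← hlow 1 1 (by decide) (by decide) t ht, ← hlow 1 2 (by decide) (by decide) t ht,
    ← hlow 2 2 (by decide) (by decide) t ht]
  linear_combination 2 * (shapeMatrix β e t 1 1 + shapeMatrix β e t 2 2) *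
    (1 - shapeMatrix β e 0 0 0 * bint β t) * (hsol ht).2

/-- The Hamiltonian function along a flow with `λ ≠ 0`. -/
theorem hamiltonian_of_lam_ne_zero (h : IsLeftInvariantFlow J β e) {p : G} (hl : lam β e p ≠ 0)
    {t : ℝ} (ht : t ∈ J) :
    |phase β e p t| < Real.pi / 2 ∧
      hamiltonian β e t p =
        lam β e p ^ 2 * hamiltonian β e 0 p / (lam β e p ^ 2 + shapeComp β e 0 0 0 p ^ 2) *
          (1 / Real.cos (phase β e p t)) ^ 2 := by
  have hy : phase β e p t = Real.arctan (shapeMatrix β e t 0 0 / lam β e p) := by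
    rw [phase, h.shapeComp_eq h.zero_mem]
    exact riccati_pos (u := fun s => shapeMatrix β e s 0 0) h.isOpen h.ordConnected h.zero_mem
      h.smooth_beta.continuousOn hl (fun s hs => h.hasDerivAt_shapeMatrix_zero_zero p hs) ht
  rw [hy]
  refine ⟨abs_lt.2 ⟨Real.neg_pi_div_two_lt_arctan _, Real.arctan_lt_pi_div_two _⟩, ?_⟩
  have hl2 : lam β e p ^ 2 ≠ 0 := pow_ne_zero 2 hl
  -- Here `sec² (arctan (u / λ)) = (λ² + u²) / λ²`, and the factor `λ² + u₀²` cancels against the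
  -- initial Hamiltonian.
  rw [h.hamiltonian_eq_of_ne_zero ht (by rwa [← h.lam_sq' ht p]),
    h.hamiltonian_eq_of_ne_zero h.zero_mem (by rwa [← h.lam_sq p]), ← h.lam_sq' ht p,
    ← h.lam_sq p, h.shapeComp_eq h.zero_mem, div_pow, one_pow, Real.cos_sq_arctan]
  have h1 : lam β e p ^ 2 + shapeMatrix β e 0 0 0 ^ 2 ≠ 0 := by positivity
  field_simp

theorem hamiltonian_eq_zero_iff (h : IsLeftInvariantFlow J β e) (p : G) {t : ℝ} (ht : t ∈ J) :
    hamiltonian β e t p = 0 ↔ hamiltonian β e 0 p = 0 := by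
  by_cases hl : lam β e p = 0
  · obtain ⟨hw, hH⟩ := h.hamiltonian_of_lam_eq_zero hl ht
    rw [hH, div_eq_zero_iff, or_iff_left (pow_ne_zero 2 hw.ne')]
  · obtain ⟨hy, hH⟩ := h.hamiltonian_of_lam_ne_zero hl ht
    have hcos : Real.cos (phase β e p t) ≠ 0 :=
      (Real.cos_pos_of_mem_Ioo (abs_lt.1 hy |>.imp (by intro h; linarith) id)).ne'
    have h1 : lam β e p ^ 2 + shapeComp β e 0 0 0 p ^ 2 ≠ 0 := by positivity
    rw [hH]
    simp [hl, hcos, h1]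

end IsLeftInvariantFlow
end Hamiltonian

end ParallelSpinor

theorem mainTheorem8 {G : Type*} [TopologicalSpace G]
    [ChartedSpace (EuclideanSpace ℝ (Fin 3)) G] [Group G] [LieGroup (𝓡 3) ∞ G]
    [SimplyConnectedSpace G]
    (J : Set ℝ) (β : ℝ → ℝ) (e : ℝ → ParallelSpinor.Coframe G)
    (hflow : ParallelSpinor.IsLeftInvariantFlow J β e) :
    -- the initial components and the Hamiltonian functions are constant on `G`
    (∀ (a b : Fin 3) (p q : G),
      ParallelSpinor.shapeComp β e 0 a b p = ParallelSpinor.shapeComp β e 0 a b q) ∧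
    (∀ t ∈ J, ∀ p q : G,
      ParallelSpinor.hamiltonian β e t p = ParallelSpinor.hamiltonian β e t q) ∧
    -- the case `λ = 0`
    (∀ p : G, ParallelSpinor.lam β e p = 0 → ∀ t ∈ J,
      0 < 1 - ParallelSpinor.shapeComp β e 0 0 0 p * ParallelSpinor.bint β t ∧
      ParallelSpinor.hamiltonian β e t p =
        ParallelSpinor.hamiltonian β e 0 p /
          (1 - ParallelSpinor.shapeComp β e 0 0 0 p * ParallelSpinor.bint β t) ^ 2) ∧
    -- the case `λ ≠ 0`
    (∀ p : G, ParallelSpinor.lam β e p ≠ 0 → ∀ t ∈ J,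
      |ParallelSpinor.phase β e p t| < Real.pi / 2 ∧
      ParallelSpinor.hamiltonian β e t p =
        ParallelSpinor.lam β e p ^ 2 * ParallelSpinor.hamiltonian β e 0 p /
            (ParallelSpinor.lam β e p ^ 2 + ParallelSpinor.shapeComp β e 0 0 0 p ^ 2) *
          (1 / Real.cos (ParallelSpinor.phase β e p t)) ^ 2) ∧
    -- vanishing at one time, at all times, and at the initial time are equivalent
    (∀ p : G, ∀ t ∈ J,
      (ParallelSpinor.hamiltonian β e t p = 0 ↔ ParallelSpinor.hamiltonian β e 0 p = 0)) ∧
    (∀ p : G, (∀ t ∈ J, ParallelSpinor.hamiltonian β e t p = 0) ↔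
      ParallelSpinor.hamiltonian β e 0 p = 0) := by
  refine ⟨fun a b p q => ?_, fun t ht p q => ?_,
    fun p hl t ht => hflow.hamiltonian_of_lam_eq_zero hl ht,
    fun p hl t ht => hflow.hamiltonian_of_lam_ne_zero hl ht,
    fun p t ht => hflow.hamiltonian_eq_zero_iff p ht,
    fun p => ⟨fun h => h 0 hflow.zero_mem,
      fun h t ht => (hflow.hamiltonian_eq_zero_iff p ht).2 h⟩⟩
  · rw [hflow.shapeComp_eq hflow.zero_mem, hflow.shapeComp_eq hflow.zero_mem]
  · rw [hflow.hamiltonian_eq ht, hflow.hamiltonian_eq ht]
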